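/- Let $d \ge 1$ be an integer, and let $\vee^2\mathbb{C}^d$ be the symmetric subspace of $\mathbb{C}^d\otimes\mathbb{C}^d$ (the tensors fixed by the swap $a\otimes b\mapsto b\otimes a$), with the inner product inherited from $\mathbb{C}^d\otimes\mathbb{C}^d$. A state is a unit vector of $\vee^2\mathbb{C}^d$. It is called a product state (or coherent state) if it has the form $\alpha\otimes\alpha$ for some $\alpha\in\mathbb{C}^d$, and entangled otherwise. A unitary operator $U$ on $\vee^2\mathbb{C}^d$ is called a bosonic universal entangler (BUE) if it maps every product state to an entangled state. There is a bosonic universal entangler on $\vee^2\mathbb{C}^d$ if and only if $d\ge 3$. Furthermore, when $d\ge 3$, almost every unitary operator on $\vee^2\mathbb{C}^d$ is a bosonic universal entangler, that is, the unitary operators on $\vee^2\mathbb{C}^d$ that are not BUEs form a null set for the Haar measure of the unitary group of $\vee^2\mathbb{C}^d$. -/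

import Mathlib

open scoped TensorProduct

noncomputable section

namespace Bosonic

/-- The single particle Hilbert space `ℂ^d`, with the Euclidean inner product. -/
abbrev Particle (d : ℕ) : Type := EuclideanSpace ℂ (Fin d)

/-- The symmetric subspace of `ℂ^d ⊗ ℂ^d`: the tensors that are fixed by the swap
`a ⊗ b ↦ b ⊗ a`. -/
def symSubspace (d : ℕ) : Submodule ℂ (Particle d ⊗[ℂ] Particle d) :=
  LinearMap.eqLocus (TensorProduct.comm ℂ (Particle d) (Particle d)).toLinearMap LinearMap.id

/-- `∨² ℂ^d`: the symmetric subspace as a Hilbert space, with the inner product inherited from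
`ℂ^d ⊗ ℂ^d`, which is determined by `⟪a ⊗ b, a' ⊗ b'⟫ = ⟪a, a'⟫ * ⟪b, b'⟫`. -/
def SymSquare (d : ℕ) : Type := symSubspace d

instance instNormedAddCommGroupSymSquare (d : ℕ) : NormedAddCommGroup (SymSquare d) :=
  Submodule.normedAddCommGroup (symSubspace d)

instance instInnerProductSpaceSymSquare (d : ℕ) : InnerProductSpace ℂ (SymSquare d) :=
  Submodule.innerProductSpace (symSubspace d)

/-- The inclusion of `∨² ℂ^d` into `ℂ^d ⊗ ℂ^d`. -/
def incl (d : ℕ) : SymSquare d →ₗᵢ[ℂ] Particle d ⊗[ℂ] Particle d :=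
  (symSubspace d).subtypeₗᵢ

instance instFiniteDimensionalSymSquare (d : ℕ) : FiniteDimensional ℂ (SymSquare d) :=
  Module.Finite.of_injective (incl d).toLinearMap (incl d).injective

instance instCompleteSpaceSymSquare (d : ℕ) : CompleteSpace (SymSquare d) :=
  FiniteDimensional.complete ℂ (SymSquare d)

/-- A (pure) state is a unit vector; it is a product (coherent) state if it is `α ⊗ α` for some
`α`. -/
def IsProductState {d : ℕ} (ψ : SymSquare d) : Prop :=
  ‖ψ‖ = 1 ∧ ∃ α : Particle d, incl d ψ = α ⊗ₜ[ℂ] α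

/-- An entangled state is a state that is not a product state. -/
def IsEntangledState {d : ℕ} (ψ : SymSquare d) : Prop :=
  ‖ψ‖ = 1 ∧ ¬ IsProductState ψ

/-- The quantum gates acting on `∨² ℂ^d`: its group of unitary operators, with the topology and the
Borel σ-algebra of the operator norm. -/
abbrev Gate (d : ℕ) : Type := unitary (SymSquare d →L[ℂ] SymSquare d)

/-- `U` is a bosonic universal entangler: it maps every product state to an entangled state. -/
def IsBUE {d : ℕ} (U : Gate d) : Prop :=
  ∀ ψ : SymSquare d, IsProductState ψ →
    IsEntangledState ((U : SymSquare d →L[ℂ] SymSquare d) ψ)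

instance instCompactSpaceGate (d : ℕ) : CompactSpace (Gate d) := by
  have : ProperSpace (SymSquare d →L[ℂ] SymSquare d) :=
    FiniteDimensional.proper ℂ _
  refine isCompact_iff_compactSpace.mp (Metric.isCompact_of_isClosed_isBounded ?_ ?_)
  · exact isClosed_unitary
  · refine (Metric.isBounded_closedBall (x := (0 : SymSquare d →L[ℂ] SymSquare d))
      (r := 1)).subset fun U hU => ?_
    rw [mem_closedBall_zero_iff]
    exact ContinuousLinearMap.opNorm_le_bound _ zero_le_one fun x => by
      rw [one_mul, ContinuousLinearMap.norm_map_of_mem_unitary hU]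

/-- The Haar probability measure on the unitary group of `∨² ℂ^d`. -/
def gateMeasure (d : ℕ) : MeasureTheory.Measure (Gate d) :=
  MeasureTheory.Measure.haarMeasure ⊤

end Bosonic

end

/-! For `3 ≤ d` the proof is a dimension count made quantitative. Let `n` be the real dimension of
the symmetric square. If `U` is not a BUE, it sends some `sq α` to some `sq β` with `α`, `β` unit
vectors, and then nearly does so on whole `ε`-balls around `α` and `β`: a set of pairs of volume of
order `ε ^ (4 * d)` (`le_measure_nearTriples`). Conversely, a fixed pair `(a, b)` is nearly matched
by a Haar random `U` with probability of order at most `ε ^ (n - 1)` (`measure_norm_apply_sub_le`),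
and the relevant pairs lie in two shells of volume `O(ε)` each. Fubini and Markov bound the bad
gates by `O(ε ^ (n + 1 - 4 * d))`. Since `n ≥ d * (d + 1) ≥ 4 * d`, this tends to 0.

For `d = 1` every symmetric tensor is a square. For `d = 2` squares are the tensors of zero
determinant, and the determinant of `U (sq α)` is a binary quartic form in `α`, which has a
nontrivial zero over `ℂ`. -/

namespace Bosonic

open MeasureTheory Module Metric

/-! ### Volumes of spherical shells -/

section Shell

variable {E : Type*} [NormedAddCommGroup E] [NormedSpace ℝ E] [FiniteDimensional ℝ E]
  [MeasurableSpace E] [BorelSpace E] (ν : Measure E) [ν.IsAddHaarMeasure]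

/-- A spherical shell of inner radius `r` and thickness `δ` has volume at least of order `δ`. -/
theorem le_measure_shell [Nontrivial E] {r δ : ℝ} (hr : 0 ≤ r) (hδ : 0 ≤ δ) :
    ENNReal.ofReal (δ * r ^ (finrank ℝ E - 1)) * ν (ball 0 1)
      ≤ ν {y | r ≤ ‖y‖ ∧ ‖y‖ ≤ r + δ} := by
  have hn : finrank ℝ E = (finrank ℝ E - 1) + 1 := by
    have := finrank_pos (R := ℝ) (M := E); omega
  have hset : {y : E | r ≤ ‖y‖ ∧ ‖y‖ ≤ r + δ} = closedBall 0 (r + δ) \ ball 0 r := by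
    ext y; simp [and_comm]
  rw [hset]
  refine le_trans ?_ le_measure_sdiff
  rw [Measure.addHaar_closedBall ν 0 (add_nonneg hr hδ), Measure.addHaar_ball ν 0 hr,
    ← ENNReal.sub_mul (fun _ _ => measure_ball_lt_top.ne), ← ENNReal.ofReal_sub _ (by positivity)]
  gcongr
  set n := finrank ℝ E - 1
  -- The bound is `(r + δ) ^ (n + 1) ≥ r ^ n * (r + δ)`, with `n` now the dimension minus one.
  rw [hn, pow_succ, pow_succ]
  have : r ^ n ≤ (r + δ) ^ n := by gcongr; linarith
  nlinarith [mul_le_mul_of_nonneg_right this (add_nonneg hr hδ)]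

/-- The spherical shell of thickness `2 * ε` around the unit sphere has volume at most of
order `ε`. -/
theorem measure_shell_le [Nontrivial E] {ε : ℝ} (hε : 0 ≤ ε) (hε1 : ε ≤ 1) :
    ν {y : E | |‖y‖ - 1| ≤ ε}
      ≤ ENNReal.ofReal (finrank ℝ E * 2 ^ finrank ℝ E * ε) * ν (ball 0 1) := by
  have hset : {y : E | |‖y‖ - 1| ≤ ε} = closedBall 0 (1 + ε) \ ball 0 (1 - ε) := by
    ext y; simp only [Set.mem_ofPred_eq, abs_le, Set.mem_sdiff, mem_closedBall_zero_iff,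
      mem_ball_zero_iff, not_lt]
    constructor <;> rintro ⟨h1, h2⟩ <;> constructor <;> linarith
  have hsub : ball (0 : E) (1 - ε) ⊆ closedBall 0 (1 + ε) :=
    (ball_subset_ball (by linarith)).trans ball_subset_closedBall
  rw [hset, measure_sdiff hsub measurableSet_ball.nullMeasurableSet measure_ball_lt_top.ne,
    Measure.addHaar_closedBall ν 0 (r := 1 + ε) (by linarith),
    Measure.addHaar_ball ν 0 (r := 1 - ε) (by linarith),
    ← ENNReal.sub_mul (fun _ _ => measure_ball_lt_top.ne),
    ← ENNReal.ofReal_sub _ (pow_nonneg (by linarith) _)]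
  gcongr
  set n := finrank ℝ E
  have h := (le_abs_self _).trans (abs_pow_sub_pow_le (1 + ε) (1 - ε) n)
  rw [abs_of_nonneg (by linarith : 0 ≤ 1 + ε), abs_of_nonneg (by linarith : 0 ≤ 1 - ε),
    max_eq_left (by linarith : 1 - ε ≤ 1 + ε),
    abs_of_nonneg (by linarith : 0 ≤ 1 + ε - (1 - ε))] at h
  refine h.trans ?_
  have hn : n = (n - 1) + 1 := by
    have := finrank_pos (R := ℝ) (M := E); omega
  have h2 : (2 : ℝ) ^ n = 2 ^ (n - 1) * 2 := by conv_lhs => rw [hn, pow_succ]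
  have h3 : (1 + ε) ^ (n - 1) ≤ 2 ^ (n - 1) := by gcongr; linarith
  rw [h2]
  calc (1 + ε - (1 - ε)) * n * (1 + ε) ^ (n - 1) = n * (1 + ε) ^ (n - 1) * (2 * ε) := by ring
    _ ≤ n * 2 ^ (n - 1) * (2 * ε) := by gcongr
    _ = _ := by ring

end Shell

/-! ### Small-ball estimate for the orbit of a vector under a random unitary -/

section Orbit

variable {E : Type*} [NormedAddCommGroup E] [InnerProductSpace ℂ E] [FiniteDimensional ℂ E]
  [CompleteSpace E]

/-- The unitary group acts transitively on spheres. -/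
theorem exists_unitary_apply_eq {y z : E} (hy : y ≠ 0) (h : ‖y‖ = ‖z‖) :
    ∃ W : unitary (E →L[ℂ] E), (W : E →L[ℂ] E) y = z := by
  -- A rank-one map with `y ↦ z`; it is isometric on the line of `y`, and that isometry extends to
  -- all of `E`.
  let T : E →ₗ[ℂ] E := (innerₛₗ ℂ y).smulRight (((‖y‖ : ℂ) ^ 2)⁻¹ • z)
  have hT (c : ℂ) : T (c • y) = c • z := by
    have hy' : (‖y‖ : ℂ) ≠ 0 := by exact_mod_cast norm_ne_zero_iff.2 hy
    simp only [T, LinearMap.smulRight_apply, innerₛₗ_apply_apply, inner_smul_right,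
      inner_self_eq_norm_sq_to_K, smul_smul]
    congr 1
    simp only [Complex.coe_algebraMap]
    field_simp
  let L : Submodule.span ℂ {y} →ₗᵢ[ℂ] E :=
    { T.domRestrict _ with
      norm_map' := by
        rintro ⟨v, hv⟩
        obtain ⟨c, rfl⟩ := Submodule.mem_span_singleton.1 hv
        change ‖T (c • y)‖ = ‖c • y‖
        rw [hT, norm_smul, norm_smul, h] }
  let e : E ≃ₗᵢ[ℂ] E := L.extend.toLinearIsometryEquiv rfl
  refine ⟨Unitary.linearIsometryEquiv.symm e, ?_⟩
  change L.extend y = z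
  have := L.extend_apply ⟨y, Submodule.mem_span_singleton_self y⟩
  rw [this]
  change T y = z
  simpa using hT 1

variable [MeasurableSpace E] [BorelSpace E]
  (μ : Measure (unitary (E →L[ℂ] E))) [μ.IsMulLeftInvariant] [IsProbabilityMeasure μ]

open ContinuousLinearMap in
/-- The probability that a Haar random unitary operator maps `x` into the `δ`-ball around `y` is
at most of order `δ ^ (n - 1)`, where `n` is the real dimension of the space. -/
theorem measure_norm_apply_sub_le [Nontrivial E] {r : ℝ} (hr : 0 < r) (x y : E) (hy : r ≤ ‖y‖)
    {δ : ℝ} (hδ : 0 < δ) :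
    μ {U | ‖(U : E →L[ℂ] E) x - y‖ ≤ δ}
      ≤ ENNReal.ofReal (2 ^ finrank ℝ E / r ^ (finrank ℝ E - 1) * δ ^ (finrank ℝ E - 1)) := by
  let ν : Measure E := Measure.addHaar
  set n := finrank ℝ E with hn
  have hn1 : n = (n - 1) + 1 := by
    have := finrank_pos (R := ℝ) (M := E); omega
  set m := μ {U | ‖(U : E →L[ℂ] E) x - y‖ ≤ δ}
  have hy0 : y ≠ 0 := norm_pos_iff.1 (hr.trans_le hy)
  -- Double counting on `P`: every target `z` in the shell `S` is hit to within `2 * δ` with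
  -- probability at least `m`, while each `U` hits only a ball of targets.
  let S : Set E := {z | ‖y‖ ≤ ‖z‖ ∧ ‖z‖ ≤ ‖y‖ + δ}
  let P : Set (unitary (E →L[ℂ] E) × E) := {p | ‖(p.1 : E →L[ℂ] E) x - p.2‖ ≤ 2 * δ}
  have hP : MeasurableSet P := by
    refine (isClosed_le ?_ continuous_const).measurableSet
    fun_prop
  have hS : MeasurableSet S := by
    refine IsClosed.measurableSet ?_
    exact (isClosed_le continuous_const continuous_norm).inter
      (isClosed_le continuous_norm continuous_const)
  have hmS : ∀ z ∈ S, m ≤ μ ((fun U => (U, z)) ⁻¹' P) := by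
    rintro z ⟨hz1, hz2⟩
    have hz0 : 0 < ‖z‖ := (norm_pos_iff.2 hy0).trans_le hz1
    -- The radial projection of `z` to the sphere through `y`: a unitary carries `y` to `w`, at
    -- distance at most `δ` from `z`, and left invariance transports the event.
    let w : E := ((‖y‖ / ‖z‖ : ℝ) : ℂ) • z
    have hw : ‖w‖ = ‖y‖ := by
      rw [norm_smul, Complex.norm_real, norm_div, norm_norm, norm_norm,
        div_mul_cancel₀ _ hz0.ne']
    have hwz : ‖w - z‖ ≤ δ := by
      have : w - z = ((‖y‖ / ‖z‖ - 1 : ℝ) : ℂ) • z := by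
        rw [Complex.ofReal_sub, sub_smul, Complex.ofReal_one, one_smul]
      rw [this, norm_smul, Complex.norm_real, Real.norm_eq_abs]
      have h1 : ‖y‖ / ‖z‖ - 1 ≤ 0 := by
        rw [sub_nonpos, div_le_one hz0]; exact hz1
      rw [abs_of_nonpos h1]
      have : -(‖y‖ / ‖z‖ - 1) * ‖z‖ = ‖z‖ - ‖y‖ := by field_simp; ring
      linarith
    obtain ⟨W, hW⟩ := exists_unitary_apply_eq hy0 hw.symm
    rw [← measure_preimage_mul μ W]
    refine measure_mono fun U hU => ?_
    have hU' : ‖(U : E →L[ℂ] E) x - y‖ ≤ δ := hU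
    change ‖(W : E →L[ℂ] E) ((U : E →L[ℂ] E) x) - z‖ ≤ 2 * δ
    have h2 : ‖(W : E →L[ℂ] E) ((U : E →L[ℂ] E) x) - w‖ ≤ δ := by
      rw [← hW, ← map_sub, norm_map_of_mem_unitary W.2]; exact hU'
    linarith [norm_sub_le_norm_sub_add_norm_sub ((W : E →L[ℂ] E) ((U : E →L[ℂ] E) x)) w z]
  have hupper : (μ.prod ν) P = ENNReal.ofReal ((2 * δ) ^ n) * ν (ball 0 1) := by
    rw [Measure.prod_apply hP]
    have : ∀ U : unitary (E →L[ℂ] E), ν (Prod.mk U ⁻¹' P)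
        = ENNReal.ofReal ((2 * δ) ^ n) * ν (ball 0 1) := fun U => by
      rw [hn, ← Measure.addHaar_closedBall ν ((U : E →L[ℂ] E) x) (by positivity)]
      congr 1
      ext z
      simp [P, dist_eq_norm_sub']
    simp [this]
  have hlower : m * ν S ≤ (μ.prod ν) P := by
    rw [Measure.prod_apply_symm hP, ← setLIntegral_const]
    exact (setLIntegral_mono' hS hmS).trans (setLIntegral_le_lintegral _ _)
  have hv0 : ν (ball 0 1) ≠ 0 := (measure_ball_pos ν 0 one_pos).ne'
  have hvt : ν (ball 0 1) ≠ ⊤ := measure_ball_lt_top.ne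
  have key : m * (ENNReal.ofReal (δ * r ^ (n - 1)) * ν (ball 0 1))
      ≤ ENNReal.ofReal ((2 * δ) ^ n) * ν (ball 0 1) := by
    rw [← hupper]
    refine le_trans ?_ hlower
    gcongr
    refine le_trans ?_ (le_measure_shell ν (norm_nonneg y) hδ.le)
    gcongr
  rw [← mul_assoc, ENNReal.mul_le_mul_iff_left hv0 hvt] at key
  have hpos : 0 < δ * r ^ (n - 1) := by positivity
  rw [← ENNReal.le_div_iff_mul_le (Or.inl (by simpa using hpos)) (Or.inl ENNReal.ofReal_ne_top),
    ← ENNReal.ofReal_div_of_pos hpos] at key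
  refine key.trans (ENNReal.ofReal_le_ofReal (le_of_eq ?_))
  rw [mul_pow]
  nth_rewrite 2 [hn1]
  rw [pow_succ]
  field_simp

end Orbit

/-! ### Squares `α ⊗ α` and product states -/

variable {d : ℕ}

/-- The vector `α ⊗ α` of the symmetric square. -/
def sq (α : Particle d) : SymSquare d :=
  ⟨α ⊗ₜ[ℂ] α, by simp [symSubspace]⟩

theorem incl_sq (α : Particle d) : incl d (sq α) = α ⊗ₜ[ℂ] α := rfl

theorem norm_sq (α : Particle d) : ‖sq α‖ = ‖α‖ ^ 2 := by
  rw [← (incl d).norm_map, incl_sq, TensorProduct.norm_tmul, _root_.sq]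

theorem sq_smul (c : ℂ) (α : Particle d) : sq (c • α) = c ^ 2 • sq α := by
  apply (incl d).injective
  rw [map_smul, incl_sq, incl_sq, TensorProduct.smul_tmul_smul, _root_.sq]

theorem norm_sq_sub_sq_le (α β : Particle d) :
    ‖sq α - sq β‖ ≤ ‖α - β‖ * (‖α‖ + ‖β‖) := by
  rw [← (incl d).norm_map, map_sub, incl_sq, incl_sq]
  have : α ⊗ₜ[ℂ] α - β ⊗ₜ[ℂ] β = (α - β) ⊗ₜ[ℂ] α + β ⊗ₜ[ℂ] (α - β) := by
    rw [TensorProduct.sub_tmul, TensorProduct.tmul_sub]; abel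
  rw [this]
  refine (norm_add_le _ _).trans (le_of_eq ?_)
  rw [TensorProduct.norm_tmul, TensorProduct.norm_tmul]; ring

theorem continuous_sq : Continuous (sq : Particle d → SymSquare d) := by
  refine continuous_iff_continuousAt.2 fun β => tendsto_iff_norm_sub_tendsto_zero.2 ?_
  refine squeeze_zero (fun _ => norm_nonneg _) (fun α => norm_sq_sub_sq_le α β) ?_
  have : Continuous fun α : Particle d => ‖α - β‖ * (‖α‖ + ‖β‖) := by fun_prop
  simpa using this.tendsto β

theorem isProductState_iff {ψ : SymSquare d} :
    IsProductState ψ ↔ ∃ α : Particle d, ‖α‖ = 1 ∧ ψ = sq α := by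
  constructor
  · rintro ⟨h1, α, hα⟩
    have hψ : ψ = sq α := (incl d).injective hα
    refine ⟨α, ?_, hψ⟩
    rw [hψ, norm_sq] at h1
    exact (pow_eq_one_iff_of_nonneg (norm_nonneg α) two_ne_zero).1 h1
  · rintro ⟨α, h, rfl⟩
    exact ⟨by rw [norm_sq, h, one_pow], α, rfl⟩

theorem not_isBUE_iff {U : Gate d} :
    ¬ IsBUE U ↔ ∃ α β : Particle d, ‖α‖ = 1 ∧ ‖β‖ = 1 ∧
      (U : SymSquare d →L[ℂ] SymSquare d) (sq α) = sq β := by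
  constructor
  · intro h
    simp only [IsBUE, not_forall, IsEntangledState, not_and, not_not] at h
    obtain ⟨ψ, hψ, h⟩ := h
    obtain ⟨α, hα, rfl⟩ := isProductState_iff.1 hψ
    obtain ⟨β, hβ, h⟩ := isProductState_iff.1
      (h (by rw [ContinuousLinearMap.norm_map_of_mem_unitary U.2]; exact hψ.1))
    exact ⟨α, β, hα, hβ, h⟩
  · rintro ⟨α, β, hα, hβ, h⟩ hU
    exact (hU _ (isProductState_iff.2 ⟨α, hα, rfl⟩)).2 (isProductState_iff.2 ⟨β, hβ, h⟩)

/-! ### Coordinates and dimension of the symmetric square -/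

section Dimension

/-- The coordinate basis of `ℂ^d ⊗ ℂ^d`. -/
noncomputable def tensorBasis (d : ℕ) : Basis (Fin d × Fin d) ℂ (Particle d ⊗[ℂ] Particle d) :=
  (EuclideanSpace.basisFun (Fin d) ℂ).toBasis.tensorProduct
    (EuclideanSpace.basisFun (Fin d) ℂ).toBasis

theorem tensorBasis_repr_tmul (α β : Particle d) (p : Fin d × Fin d) :
    (tensorBasis d).repr (α ⊗ₜ[ℂ] β) p = α p.1 * β p.2 := by
  obtain ⟨i, j⟩ := p
  rw [tensorBasis, Basis.tensorProduct_repr_tmul_apply]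
  simp [mul_comm]

theorem tensorBasis_repr_comm (t : Particle d ⊗[ℂ] Particle d) (i j : Fin d) :
    (tensorBasis d).repr (TensorProduct.comm ℂ _ _ t) (i, j) = (tensorBasis d).repr t (j, i) := by
  induction t with
  | zero => simp
  | add x y hx hy => simp [hx, hy]
  | tmul α β => rw [TensorProduct.comm_tmul, tensorBasis_repr_tmul, tensorBasis_repr_tmul, mul_comm]

theorem mem_symSubspace_iff {t : Particle d ⊗[ℂ] Particle d} :
    t ∈ symSubspace d ↔ ∀ i j, (tensorBasis d).repr t (i, j) = (tensorBasis d).repr t (j, i) := by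
  have : t ∈ symSubspace d ↔ TensorProduct.comm ℂ _ _ t = t := Iff.rfl
  rw [this, (tensorBasis d).ext_elem_iff]
  simp only [Prod.forall, tensorBasis_repr_comm]
  exact ⟨fun h i j => (h i j).symm, fun h i j => (h i j).symm⟩

/-- The symmetric tensor with prescribed coordinates. -/
noncomputable def ofSymm (d : ℕ) : (Sym2 (Fin d) → ℂ) →ₗ[ℂ] SymSquare d :=
  LinearMap.codRestrict (symSubspace d)
    ((tensorBasis d).equivFun.symm.toLinearMap ∘ₗ
      LinearMap.funLeft ℂ ℂ fun p : Fin d × Fin d => s(p.1, p.2)) fun f => by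
    rw [mem_symSubspace_iff]
    intro i j
    simp only [← Basis.equivFun_apply, LinearMap.comp_apply, LinearEquiv.coe_coe,
      LinearEquiv.apply_symm_apply, LinearMap.funLeft_apply, Sym2.eq_swap]

theorem ofSymm_injective (d : ℕ) : Function.Injective (ofSymm d) := by
  intro f g h
  have h' := (tensorBasis d).equivFun.symm.injective (congrArg (incl d) h)
  funext z
  induction z with
  | _ i j => exact congrFun h' (i, j)

/-- Functions on unordered pairs of indices embed by `ofSymm`; there are `(d + 1).choose 2` such
pairs, and passing to real dimension doubles the count. Only this inequality is needed. -/
theorem le_finrank_symSquare (d : ℕ) : d * (d + 1) ≤ finrank ℝ (SymSquare d) := by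
  have h := LinearMap.finrank_le_finrank_of_injective (ofSymm_injective d)
  rw [finrank_fintype_fun_eq_card, Sym2.card, Fintype.card_fin] at h
  rw [finrank_real_of_complex]
  have h3 : (d + 1).choose 2 * 2 = (d + 1) * d := by
    have := Nat.add_one_mul_choose_eq d 1
    rw [Nat.choose_one_right] at this
    exact this.symm
  nlinarith

end Dimension

theorem finrank_real_particle (d : ℕ) : finrank ℝ (Particle d) = 2 * d := by
  rw [finrank_real_of_complex, finrank_euclideanSpace_fin]

instance instIsHaarMeasureGateMeasure (d : ℕ) : (gateMeasure d).IsHaarMeasure := by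
  unfold gateMeasure; infer_instance

instance instIsProbabilityMeasureGateMeasure (d : ℕ) : IsProbabilityMeasure (gateMeasure d) :=
  ⟨by unfold gateMeasure; exact Measure.haarMeasure_self⟩

/-! ### Almost every gate is a BUE when `3 ≤ d` -/

section AlmostEvery

variable (d)

noncomputable instance instMeasurableSpaceSymSquare : MeasurableSpace (SymSquare d) := borel _

instance instBorelSpaceSymSquare : BorelSpace (SymSquare d) := ⟨rfl⟩

/-- The vectors of norm within `ε` of `1`. -/
def shell (ε : ℝ) : Set (Particle d) := {α | |‖α‖ - 1| ≤ ε}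

variable {d} in
theorem mem_shell {ε : ℝ} {α : Particle d} : α ∈ shell d ε ↔ |‖α‖ - 1| ≤ ε := Iff.rfl

theorem measurableSet_shell (ε : ℝ) : MeasurableSet (shell d ε) :=
  (isClosed_le (by fun_prop) continuous_const).measurableSet

theorem closedBall_subset_shell {ε : ℝ} {α : Particle d} (hα : ‖α‖ = 1) :
    closedBall α ε ⊆ shell d ε := fun a ha => by
  rw [mem_closedBall, dist_eq_norm] at ha
  have := (abs_norm_sub_norm_le a α).trans ha
  rwa [hα] at this

/-- The triples `(U, a, b)` for which `a`, `b` are nearly unit vectors and `U` nearly maps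
`a ⊗ a` to `b ⊗ b`. -/
def nearTriples (ε : ℝ) : Set (Gate d × Particle d × Particle d) :=
  {p | (p.2.1 ∈ shell d ε ∧ p.2.2 ∈ shell d ε) ∧
    ‖(p.1 : SymSquare d →L[ℂ] SymSquare d) (sq p.2.1) - sq p.2.2‖ ≤ 6 * ε}

theorem measurableSet_nearTriples (ε : ℝ) : MeasurableSet (nearTriples d ε) := by
  have h1 : MeasurableSet {p : Gate d × Particle d × Particle d |
      p.2.1 ∈ shell d ε ∧ p.2.2 ∈ shell d ε} :=
    ((measurableSet_shell d ε).preimage (by fun_prop)).inter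
      ((measurableSet_shell d ε).preimage (by fun_prop))
  have h2 : MeasurableSet {p : Gate d × Particle d × Particle d |
      ‖(p.1 : SymSquare d →L[ℂ] SymSquare d) (sq p.2.1) - sq p.2.2‖ ≤ 6 * ε} := by
    have hs := continuous_sq (d := d)
    exact (isClosed_le (by fun_prop) continuous_const).measurableSet
  exact h1.inter h2

/-- A gate that is not universally entangling is nearly compatible with a definite proportion of
the nearly unit vectors. -/
theorem le_measure_nearTriples {ε : ℝ} (hε : 0 < ε) (hε2 : ε ≤ 1 / 2) {U : Gate d}
    (hU : ¬ IsBUE U) :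
    (ENNReal.ofReal (ε ^ (2 * d)) * (volume : Measure (Particle d)) (ball 0 1)) ^ 2
      ≤ (volume : Measure (Particle d × Particle d)) (Prod.mk U ⁻¹' nearTriples d ε) := by
  obtain ⟨α, β, hα, hβ, h⟩ := not_isBUE_iff.1 hU
  have hsub : closedBall α ε ×ˢ closedBall β ε ⊆ Prod.mk U ⁻¹' nearTriples d ε := by
    rintro ⟨a, b⟩ ⟨ha, hb⟩
    refine ⟨⟨closedBall_subset_shell d hα ha, closedBall_subset_shell d hβ hb⟩, ?_⟩
    -- Here `‖c‖ + ‖γ‖ ≤ 2 + ε ≤ 3`; the two ends together give the `6 * ε` of `nearTriples`.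
    have bound : ∀ {γ c : Particle d}, ‖γ‖ = 1 → c ∈ closedBall γ ε → ‖sq c - sq γ‖ ≤ 3 * ε := by
      intro γ c hγ hc
      have h1 := (abs_le.1 (mem_shell.1 (closedBall_subset_shell d hγ hc))).2
      rw [mem_closedBall, dist_eq_norm] at hc
      refine (norm_sq_sub_sq_le c γ).trans ?_
      rw [mul_comm]
      gcongr
      linarith
    have e : (U : SymSquare d →L[ℂ] SymSquare d) (sq a) - sq b
        = (U : SymSquare d →L[ℂ] SymSquare d) (sq a - sq α) - (sq b - sq β) := by
      rw [map_sub, h]; abel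
    change ‖(U : SymSquare d →L[ℂ] SymSquare d) (sq a) - sq b‖ ≤ 6 * ε
    rw [e]
    refine (norm_sub_le _ _).trans ?_
    rw [ContinuousLinearMap.norm_map_of_mem_unitary U.2]
    linarith [bound hα ha, bound hβ hb]
  refine le_trans (le_of_eq ?_) (measure_mono hsub)
  rw [Measure.volume_eq_prod, Measure.prod_prod, Measure.addHaar_closedBall _ _ hε.le,
    Measure.addHaar_closedBall _ _ hε.le, finrank_real_particle, _root_.sq]

/-- The gates that are not universally entangling have outer measure at most of order `ε`,
for every small `ε`. -/
theorem exists_measure_not_isBUE_le (hd : 3 ≤ d) :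
    ∃ C : ℝ, ∀ ε : ℝ, 0 < ε → ε ≤ 1 / 2 →
      gateMeasure d {U | ¬ IsBUE U} ≤ ENNReal.ofReal (C * ε) := by
  have hn := le_finrank_symSquare d
  set n := finrank ℝ (SymSquare d)
  -- The decisive use of `3 ≤ d`: `d * (d + 1) ≥ 4 * d`.
  have hn1 : 4 * d ≤ n := by nlinarith
  have : Nontrivial (SymSquare d) := Module.nontrivial_of_finrank_pos (R := ℝ) (by omega)
  have : Nontrivial (Particle d) := Module.nontrivial_of_finrank_pos (R := ℝ)
    (by rw [finrank_real_particle]; omega)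
  -- The constant of `measure_norm_apply_sub_le` for radius `6 * ε`; `ε ≤ 1 / 2` forces `‖sq b‖ ≥ 1
  -- / 4` on the shell.
  let A : ℝ := 2 ^ n / (1 / 4) ^ (n - 1) * 6 ^ (n - 1)
  let B : ℝ := (2 * d : ℕ) * 2 ^ (2 * d)
  have hA : 0 ≤ A := by positivity
  have hB : 0 ≤ B := by positivity
  refine ⟨A * B ^ 2, fun ε hε hε2 => ?_⟩
  set v := (volume : Measure (Particle d)) (ball 0 1)
  have hv0 : v ≠ 0 := (measure_ball_pos volume 0 one_pos).ne'
  have hvt : v ≠ ⊤ := measure_ball_lt_top.ne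
  have hfiber : ∀ p : Particle d × Particle d,
      gateMeasure d ((fun U => (U, p)) ⁻¹' nearTriples d ε)
        ≤ (shell d ε ×ˢ shell d ε).indicator (fun _ => ENNReal.ofReal (A * ε ^ (n - 1))) p := by
    rintro ⟨a, b⟩
    by_cases hab : (a, b) ∈ shell d ε ×ˢ shell d ε
    · rw [Set.indicator_of_mem hab]
      have hb : 1 / 4 ≤ ‖sq b‖ := by
        have := (abs_le.1 (mem_shell.1 hab.2)).1
        rw [norm_sq]
        simp only at this
        nlinarith
      refine (measure_mono fun U hU => hU.2).trans
        ((measure_norm_apply_sub_le (gateMeasure d) (by norm_num) (sq a) (sq b) hb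
          (δ := 6 * ε) (by positivity)).trans (ENNReal.ofReal_le_ofReal (le_of_eq ?_)))
      rw [mul_pow, ← mul_assoc]
    · rw [Set.indicator_of_notMem hab]
      have : (fun U => (U, ((a, b) : Particle d × Particle d))) ⁻¹' nearTriples d ε = ∅ :=
        Set.eq_empty_of_forall_notMem fun U hU => hab hU.1
      rw [this, measure_empty]
  have hshell : (volume : Measure (Particle d)) (shell d ε) ≤ ENNReal.ofReal (B * ε) * v := by
    have := measure_shell_le (volume : Measure (Particle d)) hε.le (by linarith)
    rwa [finrank_real_particle] at this
  have hupper : ((gateMeasure d).prod volume) (nearTriples d ε)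
      ≤ ENNReal.ofReal (A * ε ^ (n - 1)) * (ENNReal.ofReal (B * ε) * v) ^ 2 := by
    rw [Measure.prod_apply_symm (measurableSet_nearTriples d ε)]
    refine (lintegral_mono hfiber).trans ?_
    rw [lintegral_indicator_const ((measurableSet_shell d ε).prod (measurableSet_shell d ε)),
      Measure.volume_eq_prod, Measure.prod_prod, ← _root_.sq]
    gcongr
  have hlower : (ENNReal.ofReal (ε ^ (2 * d)) * v) ^ 2 * gateMeasure d {U | ¬ IsBUE U}
      ≤ ((gateMeasure d).prod volume) (nearTriples d ε) := by
    rw [Measure.prod_apply (measurableSet_nearTriples d ε)]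
    -- Markov's inequality for the fibre volume; its superlevel set contains the bad gates, so their
    -- measurability is not needed.
    refine le_trans ?_ (mul_meas_ge_le_lintegral
      (measurable_measure_prodMk_left (measurableSet_nearTriples d ε))
      ((ENNReal.ofReal (ε ^ (2 * d)) * v) ^ 2))
    exact mul_le_mul_right (measure_mono fun U hU => le_measure_nearTriples d hε hε2 hU) _
  have key := hlower.trans hupper
  rw [mul_pow, mul_pow, ← mul_assoc, mul_right_comm,
    ENNReal.mul_le_mul_iff_left (pow_ne_zero 2 hv0) (ENNReal.pow_ne_top hvt),
    ← ENNReal.ofReal_pow (by positivity), ← ENNReal.ofReal_pow (by positivity),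
    ← ENNReal.ofReal_mul (by positivity)] at key
  have hpos : 0 < (ε ^ (2 * d)) ^ 2 := by positivity
  rw [mul_comm, ← ENNReal.le_div_iff_mul_le (Or.inl (ENNReal.ofReal_pos.2 hpos).ne')
    (Or.inl ENNReal.ofReal_ne_top), ← ENNReal.ofReal_div_of_pos hpos] at key
  refine key.trans (ENNReal.ofReal_le_ofReal ?_)
  rw [div_le_iff₀ hpos]
  -- The exponents compare as `n + 1 ≥ 4 * d + 1`: one factor `ε` is left over.
  have hexp : ε ^ (n - 1) * ε ^ 2 ≤ ε * (ε ^ (2 * d)) ^ 2 := by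
    rw [← pow_mul, ← pow_add, ← pow_succ']
    exact pow_le_pow_of_le_one hε.le (by linarith) (by omega)
  calc A * ε ^ (n - 1) * (B * ε) ^ 2 = A * B ^ 2 * (ε ^ (n - 1) * ε ^ 2) := by ring
    _ ≤ A * B ^ 2 * (ε * (ε ^ (2 * d)) ^ 2) := by gcongr
    _ = _ := by ring

theorem ae_isBUE (hd : 3 ≤ d) : ∀ᵐ U ∂(gateMeasure d), IsBUE U := by
  obtain ⟨C, hC⟩ := exists_measure_not_isBUE_le d hd
  rw [ae_iff]
  refine le_antisymm ?_ zero_le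
  have hlim : Filter.Tendsto (fun ε : ℝ => ENNReal.ofReal (C * ε)) (nhdsWithin 0 (Set.Ioi 0))
      (nhds 0) := by
    have : Continuous fun ε : ℝ => ENNReal.ofReal (C * ε) :=
      ENNReal.continuous_ofReal.comp (by fun_prop)
    simpa using (this.tendsto 0).mono_left nhdsWithin_le_nhds
  refine ge_of_tendsto hlim ?_
  filter_upwards [Ioc_mem_nhdsGT (show (0 : ℝ) < 1 / 2 by norm_num)] with ε hε
  exact hC ε hε.1 hε.2

end AlmostEvery

/-! ### No BUE for `d = 1` and `d = 2` -/

section LowDimension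

open Polynomial in
/-- A binary quartic form over `ℂ` has a nontrivial zero. -/
theorem exists_quartic_zero (q : Fin 5 → ℂ) :
    ∃ w z : ℂ, (w ≠ 0 ∨ z ≠ 0) ∧
      q 0 * w ^ 4 + q 1 * w ^ 3 * z + q 2 * w ^ 2 * z ^ 2 + q 3 * w * z ^ 3 + q 4 * z ^ 4 = 0 := by
  by_cases h4 : q 4 = 0
  -- The zero at infinity; otherwise setting `w = 1` leaves a polynomial of degree exactly 4.
  · exact ⟨0, 1, by simp, by simp [h4]⟩
  · let p : ℂ[X] := C (q 4) * X ^ 4 + C (q 3) * X ^ 3 + C (q 2) * X ^ 2 + C (q 1) * X + C (q 0)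
    have hp : p.degree = 4 := by
      simp only [p]
      compute_degree!
    obtain ⟨z, hz⟩ := IsAlgClosed.exists_root p (by rw [hp]; norm_num)
    refine ⟨1, z, by simp, ?_⟩
    simp only [p, IsRoot.def, eval_add, eval_mul, eval_C, eval_pow, eval_X] at hz
    linear_combination hz

/-- The coordinates of a symmetric tensor. -/
noncomputable def coord (i j : Fin d) : SymSquare d →ₗ[ℂ] ℂ :=
  (tensorBasis d).coord (i, j) ∘ₗ (incl d).toLinearMap

theorem coord_comm (ψ : SymSquare d) (i j : Fin d) : coord i j ψ = coord j i ψ :=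
  mem_symSubspace_iff.1 ψ.2 i j

theorem coord_sq (α : Particle d) (i j : Fin d) : coord i j (sq α) = α i * α j :=
  tensorBasis_repr_tmul α α (i, j)

theorem ext_coord {φ ψ : SymSquare d} (h : ∀ i j, coord i j φ = coord i j ψ) : φ = ψ :=
  (incl d).injective ((tensorBasis d).ext_elem fun p => h p.1 p.2)

/-- A gate that maps some nonzero `α ⊗ α` to some `β ⊗ β` is not universally entangling. -/
theorem not_isBUE_of_apply_eq {U : Gate d} {α β : Particle d} (hα : α ≠ 0)
    (h : (U : SymSquare d →L[ℂ] SymSquare d) (sq α) = sq β) : ¬ IsBUE U := by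
  have hnorm : ‖β‖ = ‖α‖ := by
    have := congrArg norm h
    rw [ContinuousLinearMap.norm_map_of_mem_unitary U.2, norm_sq, norm_sq] at this
    exact ((pow_left_inj₀ (norm_nonneg _) (norm_nonneg _) two_ne_zero).1 this).symm
  have hα' : ‖α‖ ≠ 0 := norm_ne_zero_iff.2 hα
  refine not_isBUE_iff.2 ⟨(‖α‖⁻¹ : ℂ) • α, (‖α‖⁻¹ : ℂ) • β, ?_, ?_, ?_⟩
  · rw [norm_smul]; simp [hα']
  · rw [norm_smul, hnorm]; simp [hα']
  · rw [sq_smul, sq_smul, map_smul, h]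

theorem not_isBUE_one (U : Gate 1) : ¬ IsBUE U := by
  let α : Particle 1 := EuclideanSpace.single 0 1
  have hα : α ≠ 0 := by simp [α]
  obtain ⟨c, hc⟩ := IsAlgClosed.exists_pow_nat_eq
    (coord 0 0 ((U : SymSquare 1 →L[ℂ] SymSquare 1) (sq α))) two_pos
  refine not_isBUE_of_apply_eq (β := EuclideanSpace.single 0 c) hα (ext_coord fun i j => ?_)
  rw [Subsingleton.elim i 0, Subsingleton.elim j 0, coord_sq, ← hc]
  simp [_root_.sq]

/-- A symmetric tensor over `ℂ^2` of vanishing determinant is of the form `β ⊗ β`. -/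
theorem exists_eq_sq_of_det_eq_zero (ψ : SymSquare 2)
    (h : coord 0 0 ψ * coord 1 1 ψ = coord 0 1 ψ ^ 2) : ∃ β, ψ = sq β := by
  obtain ⟨x, hx⟩ := IsAlgClosed.exists_pow_nat_eq (coord 0 0 ψ) two_pos
  obtain ⟨y, hy⟩ := IsAlgClosed.exists_pow_nat_eq (coord 1 1 ψ) two_pos
  -- The square roots `x`, `y` are only determined up to sign; the off-diagonal coordinate decides
  -- which sign of `y` to take.
  rw [← hx, ← hy, ← mul_pow, sq_eq_sq_iff_eq_or_eq_neg] at h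
  have of_mul : ∀ y : ℂ, y ^ 2 = coord 1 1 ψ → x * y = coord 0 1 ψ → ∃ β, ψ = sq β := by
    intro y hy hxy
    refine ⟨!₂[x, y], ext_coord fun i j => ?_⟩
    rw [coord_sq]
    fin_cases i <;> fin_cases j
    · simp [← hx, _root_.sq]
    · simp [← hxy]
    · simp [coord_comm ψ 1 0, ← hxy, mul_comm]
    · simp [← hy, _root_.sq]
  rcases h with h | h
  · exact of_mul y hy h
  · exact of_mul (-y) (by rw [neg_sq, hy]) (by rw [mul_neg, h, neg_neg])

theorem sq_pair (w z : ℂ) :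
    sq !₂[w, z] = w ^ 2 • sq !₂[1, 0] + z ^ 2 • sq !₂[0, 1]
      + (w * z) • (sq !₂[1, 1] - sq !₂[1, 0] - sq !₂[0, 1]) := by
  refine ext_coord fun i j => ?_
  simp only [map_add, map_sub, map_smul, coord_sq, smul_eq_mul]
  fin_cases i <;> fin_cases j <;> simp <;> ring

theorem not_isBUE_two (U : Gate 2) : ¬ IsBUE U := by
  let u : SymSquare 2 →L[ℂ] SymSquare 2 := U
  let A := u (sq !₂[1, 0])
  let B := u (sq !₂[1, 1] - sq !₂[1, 0] - sq !₂[0, 1])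
  let D := u (sq !₂[0, 1])
  -- The entries are the coefficients of the determinant of `w ^ 2 • A + (w * z) • B + z ^ 2 • D`,
  -- the image of `sq !₂[w, z]`.
  obtain ⟨w, z, hwz, h⟩ := exists_quartic_zero
    ![coord 0 0 A * coord 1 1 A - coord 0 1 A ^ 2,
      coord 0 0 A * coord 1 1 B + coord 0 0 B * coord 1 1 A - 2 * coord 0 1 A * coord 0 1 B,
      coord 0 0 A * coord 1 1 D + coord 0 0 B * coord 1 1 B + coord 0 0 D * coord 1 1 A
        - 2 * coord 0 1 A * coord 0 1 D - coord 0 1 B ^ 2,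
      coord 0 0 B * coord 1 1 D + coord 0 0 D * coord 1 1 B - 2 * coord 0 1 B * coord 0 1 D,
      coord 0 0 D * coord 1 1 D - coord 0 1 D ^ 2]
  have hu : u (sq !₂[w, z]) = w ^ 2 • A + z ^ 2 • D + (w * z) • B := by
    rw [sq_pair, map_add, map_add, map_smul, map_smul, map_smul]
  obtain ⟨β, hβ⟩ := exists_eq_sq_of_det_eq_zero (u (sq !₂[w, z])) (by
    rw [hu]
    simp only [map_add, map_smul, smul_eq_mul]
    simp only [Matrix.cons_val] at h
    linear_combination h)
  refine not_isBUE_of_apply_eq (α := !₂[w, z]) (fun h0 => ?_) hβ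
  have h1 : w = 0 := by simpa using congrArg (fun v : Particle 2 => v 0) h0
  have h2 : z = 0 := by simpa using congrArg (fun v : Particle 2 => v 1) h0
  exact hwz.elim (· h1) (· h2)

end LowDimension

end Bosonic

theorem theorem1 (d : ℕ) (hd : 1 ≤ d) :
    ((∃ U : Bosonic.Gate d, Bosonic.IsBUE U) ↔ 3 ≤ d) ∧
      (3 ≤ d → ∀ᵐ U ∂(Bosonic.gateMeasure d), Bosonic.IsBUE U) := by
  -- Existence follows from the almost-everywhere statement because the Haar measure is nonzero.
  refine ⟨⟨fun ⟨U, hU⟩ => ?_, fun h => (Bosonic.ae_isBUE d h).exists⟩, Bosonic.ae_isBUE d⟩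
  by_contra! h
  interval_cases d
  · exact Bosonic.not_isBUE_one U hU
  · exact Bosonic.not_isBUE_two U hU
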